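/- For $n\ge 1$ let $SU(n)$ be the special unitary group of $n\times n$ complex matrices with its usual topology, and let $\prod_{n=1}^{\infty}SU(n)$ carry the product topology. Let $\mathcal S=\mathcal S\bigl(\prod_{n=1}^\infty SU(n)\bigr)$ be the space of all compact subgroups of $\prod_{n=1}^{\infty}SU(n)$, topologized as a subspace of the space of nonempty compact subsets of $\prod_{n=1}^{\infty}SU(n)$ with the Vietoris topology (equivalently, with the Hausdorff metric induced by any compatible metric on the product). For a topological group $G$ let $G^\circ$ denote its identity component, that is, the connected component of the identity element. Then for the generic $G\in\mathcal S$ (that is, for all $G$ in a set whose complement is meager in $\mathcal S$) the quotient $G/G^\circ$, with the quotient topology, is homeomorphic to the Cantor set. Consequently, the generic $G\in\mathcal S$ is not connected. -/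

import Mathlib

/-- The special unitary group `SU(n)`, with the topology inherited from complex matrices. -/
abbrev SU (n : ℕ) : Type := Matrix.specialUnitaryGroup (Fin n) ℂ

instance SU.instIsTopologicalGroup (n : ℕ) : IsTopologicalGroup (SU n) where
  continuous_mul := continuous_mul
  continuous_inv := Continuous.subtype_mk (continuous_star.comp continuous_subtype_val) _

/-- The topological group `∏_{n ≥ 1} SU(n)`, with the product topology. -/
abbrev ProdSU : Type := ∀ n : ℕ+, SU (n : ℕ)

/-- The set of compact subgroups of `G` inside the space of nonempty compact subsets of `G`. As a
type it carries the subspace topology of the Vietoris topology, which is the topology of the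
Hausdorff metric of any compatible metric on `G`. -/
def CompactSubgroups (G : Type*) [TopologicalSpace G] [Group G] :
    Set (TopologicalSpace.NonemptyCompacts G) :=
  {K | ∃ H : Subgroup G, (H : Set G) = (K : Set G)}

/-- A point of the space of compact subgroups, viewed as a subgroup (with the same elements). -/
def CompactSubgroups.toSubgroup {G : Type*} [TopologicalSpace G] [Group G]
    (K : CompactSubgroups G) : Subgroup G where
  carrier := (K.1 : Set G)
  one_mem' := by obtain ⟨H, hH⟩ := K.2; rw [← hH]; exact H.one_mem
  mul_mem' := by obtain ⟨H, hH⟩ := K.2; rw [← hH]; exact H.mul_mem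
  inv_mem' := by obtain ⟨H, hH⟩ := K.2; rw [← hH]; exact H.inv_mem

/-! By homogeneity, the component group of a compact metrizable group is finite or has no isolated
points. It is compact, metrizable and totally disconnected, so in the infinite case Brouwer's
theorem makes it a Cantor set. It remains to show that generically there are infinitely many
components.

Splitting into at least `N` disjoint relatively open pieces is a Vietoris open condition. It is also
dense: keep the coordinates of `K` up to `m` and replace the rest by a product of finite cyclic
groups of order `n` in `SU n`. The result tends to `K` as `m` grows, yet coordinate `m + 1` alone
cuts it into `m + 1` open pieces. Baire genericity then gives all `N` at once. -/

open Set Filter Topology TopologicalSpace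

/-! ### Brouwer's characterization of the Cantor space -/

section Brouwer

variable {X : Type*} [TopologicalSpace X]

/-- In a totally disconnected compact Hausdorff space without isolated points, every nonempty clopen
set is split by a clopen set `V` into two nonempty parts, and `V` can be chosen to decide
membership in a prescribed clopen set `U`. -/
theorem exists_clopen_split [CompactSpace X] [T2Space X] [TotallyDisconnectedSpace X]
    (hX : ∀ x : X, ¬ IsOpen {x}) (U C : Clopens X) (hC : (C : Set X).Nonempty) :
    ∃ V : Clopens X, ((C : Set X) ∩ V).Nonempty ∧ ((C : Set X) \ V).Nonempty ∧
      ∀ x ∈ C, ∀ y ∈ C, (x ∈ V ↔ y ∈ V) → (x ∈ U ↔ y ∈ U) := by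
  by_cases h : ((C : Set X) ∩ U).Nonempty ∧ ((C : Set X) \ U).Nonempty
  · exact ⟨U, h.1, h.2, fun x _ y _ h => h⟩
  · obtain ⟨x, hx⟩ := hC
    obtain ⟨y, hy, hyx⟩ : ∃ y ∈ C, y ≠ x := by
      by_contra! hc
      apply hX x
      have : ({x} : Set X) = C :=
        Subset.antisymm (singleton_subset_iff.2 hx) fun y hy => hc y hy
      rw [this]
      exact C.isClopen.isOpen
    -- Here `U` does not split `C`, so all points of `C` agree about `U` and any clopen set
    -- separating two of them will do.
    obtain ⟨V, hV, hxV, hyV⟩ := exists_isClopen_of_totally_separated hyx.symm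
    refine ⟨⟨V, hV⟩, ⟨x, hx, hxV⟩, ⟨y, hy, hyV⟩, fun a ha b hb _ => ?_⟩
    by_contra hab
    apply h
    by_cases haU : a ∈ U
    · exact ⟨⟨a, ha, haU⟩, ⟨b, hb, fun hbU => hab (iff_of_true haU hbU)⟩⟩
    · have hbU : b ∈ U := by
        by_contra hbU
        exact hab (iff_of_false haU hbU)
      exact ⟨⟨b, hb, hbU⟩, ⟨a, ha, haU⟩⟩

/-- The tree of clopen sets obtained from the whole space by successively splitting the piece `C`
of level `n` along `V n C`. -/
def clopenTree (V : ℕ → Clopens X → Clopens X) (a : ℕ → Bool) : ℕ → Clopens X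
  | 0 => ⊤
  | n + 1 => if a n then clopenTree V a n ⊓ V n (clopenTree V a n)
      else clopenTree V a n \ V n (clopenTree V a n)

theorem clopenTree_congr (V : ℕ → Clopens X → Clopens X) {a b : ℕ → Bool} {n : ℕ}
    (h : ∀ k < n, a k = b k) : clopenTree V a n = clopenTree V b n := by
  induction n with
  | zero => rfl
  | succ n ih =>
    rw [clopenTree, clopenTree, h n n.lt_succ_self, ih fun k hk => h k (hk.trans n.lt_succ_self)]

theorem clopenTree_succ_le (V : ℕ → Clopens X → Clopens X) (a : ℕ → Bool) (n : ℕ) :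
    clopenTree V a (n + 1) ≤ clopenTree V a n := by
  rw [clopenTree]
  split_ifs
  exacts [inf_le_left, sdiff_le]

open Classical in
/-- The piece of level `n` containing `x`, in the tree of clopen sets obtained by successive
splitting along `V`. -/
noncomputable def clopenPiece (V : ℕ → Clopens X → Clopens X) (x : X) : ℕ → Clopens X
  | 0 => ⊤
  | n + 1 => if x ∈ V n (clopenPiece V x n) then clopenPiece V x n ⊓ V n (clopenPiece V x n)
      else clopenPiece V x n \ V n (clopenPiece V x n)

open Classical in
/-- The itinerary of a point through the tree of clopen sets obtained by successive splitting. -/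
noncomputable def clopenItinerary (V : ℕ → Clopens X → Clopens X) (x : X) (n : ℕ) : Bool :=
  decide (x ∈ V n (clopenPiece V x n))

theorem clopenTree_itinerary (V : ℕ → Clopens X → Clopens X) (x : X) (n : ℕ) :
    clopenTree V (clopenItinerary V x) n = clopenPiece V x n := by
  induction n with
  | zero => rfl
  | succ n ih =>
    simp only [clopenTree, clopenPiece, ih, clopenItinerary]
    congr 1
    exact propext (@decide_eq_true_iff _ (_))

/-- Tree pieces are exactly the preimages of cylinders under the itinerary map. -/
theorem mem_clopenTree_iff (V : ℕ → Clopens X → Clopens X) (x : X) (a : ℕ → Bool) (n : ℕ) :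
    x ∈ clopenTree V a n ↔ ∀ k < n, clopenItinerary V x k = a k := by
  induction n with
  | zero => exact iff_of_true trivial (by simp)
  | succ n ih =>
    rw [Nat.forall_lt_succ_right, ← ih, clopenTree]
    by_cases hx : x ∈ clopenTree V a n
    · have hp : clopenPiece V x n = clopenTree V a n := by
        rw [← clopenTree_itinerary]
        exact clopenTree_congr V (ih.1 hx)
      have hi : clopenItinerary V x n = true ↔ x ∈ V n (clopenTree V a n) := by
        simp [clopenItinerary, hp]
      cases h : a n
      · have : x ∈ clopenTree V a n \ V n (clopenTree V a n) ↔
            x ∈ clopenTree V a n ∧ x ∉ V n (clopenTree V a n) := Iff.rfl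
        simp [this, hx, ← hi]
      · have : x ∈ clopenTree V a n ⊓ V n (clopenTree V a n) ↔
            x ∈ clopenTree V a n ∧ x ∈ V n (clopenTree V a n) := Iff.rfl
        simp [this, hx, ← hi]
    · refine iff_of_false (fun h => hx ?_) (fun h => hx h.1)
      have := clopenTree_succ_le V a n
      rw [clopenTree] at this
      exact this h

/-- **Brouwer's theorem**: a nonempty compact Hausdorff second countable totally disconnected space
without isolated points is homeomorphic to the Cantor space. -/
theorem nonempty_homeomorph_nat_bool [CompactSpace X] [T2Space X] [TotallyDisconnectedSpace X]
    [SecondCountableTopology X] [Nonempty X] (hX : ∀ x : X, ¬ IsOpen {x}) :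
    Nonempty (X ≃ₜ (ℕ → Bool)) := by
  have : Countable (Clopens X) := Clopens.countable_iff_secondCountable.2 inferInstance
  obtain ⟨U, hU⟩ := exists_surjective_nat (Clopens X)
  have hex : ∀ (n : ℕ) (C : Clopens X), ∃ V : Clopens X, (C : Set X).Nonempty →
      (((C : Set X) ∩ V).Nonempty ∧ ((C : Set X) \ V).Nonempty ∧
        ∀ x ∈ C, ∀ y ∈ C, (x ∈ V ↔ y ∈ V) → (x ∈ U n ↔ y ∈ U n)) := by
    intro n C
    by_cases hC : (C : Set X).Nonempty
    · obtain ⟨V, hV⟩ := exists_clopen_split hX (U n) C hC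
      exact ⟨V, fun _ => hV⟩
    · exact ⟨⊤, fun h => absurd h hC⟩
  choose V hV using hex
  have hne : ∀ a n, (clopenTree V a n : Set X).Nonempty := by
    intro a n
    induction n with
    | zero => exact univ_nonempty
    | succ n ih =>
      rw [clopenTree]
      split_ifs
      · exact (hV n _ ih).1
      · exact (hV n _ ih).2.1
  have hmem : ∀ x n, x ∈ clopenTree V (clopenItinerary V x) n := fun x n =>
    (mem_clopenTree_iff V x _ n).2 fun _ _ => rfl
  have hcont : Continuous (clopenItinerary V) := by
    refine continuous_pi fun n => continuous_discrete_rng.2 fun b => isOpen_iff_mem_nhds.2 ?_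
    intro x hx
    have hx' : clopenItinerary V x n = b := hx
    filter_upwards [(clopenTree V (clopenItinerary V x) (n + 1)).isClopen.isOpen.mem_nhds
      (hmem x (n + 1))] with y hy
    exact ((mem_clopenTree_iff V y _ _).1 hy n n.lt_succ_self).trans hx'
  have hinj : Function.Injective (clopenItinerary V) := by
    intro x y hxy
    by_contra hne'
    -- `U` enumerates all clopen sets, so a separating `W` is some `U n`, and bit `n` of the
    -- itinerary decides membership in it.
    obtain ⟨W, hW, hxW, hyW⟩ := exists_isClopen_of_totally_separated hne'
    obtain ⟨n, hn⟩ := hU ⟨W, hW⟩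
    have hpiece : clopenPiece V x n = clopenPiece V y n := by
      rw [← clopenTree_itinerary, ← clopenTree_itinerary, hxy]
    have hx := hmem x n
    have hy := hmem y n
    rw [clopenTree_itinerary] at hx hy
    rw [← hpiece] at hy
    have h := (hV n _ ⟨x, hx⟩).2.2 x hx y hy (by
      have := congrFun hxy n
      simpa [clopenItinerary, ← hpiece] using this)
    rw [hn] at h
    exact hyW (h.1 hxW)
  have hsurj : Function.Surjective (clopenItinerary V) := by
    intro a
    obtain ⟨x, hx⟩ := IsCompact.nonempty_iInter_of_sequence_nonempty_isCompact_isClosed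
      (fun n => (clopenTree V a n : Set X)) (fun n => clopenTree_succ_le V a n) (hne a)
      (clopenTree V a 0).isClopen.isClosed.isCompact (fun n => (clopenTree V a n).isClopen.isClosed)
    refine ⟨x, funext fun n => ?_⟩
    exact (mem_clopenTree_iff V x a (n + 1)).1 (mem_iInter.1 hx (n + 1)) n n.lt_succ_self
  exact ⟨hcont.homeoOfEquivCompactToT2 (f := Equiv.ofBijective _ ⟨hinj, hsurj⟩)⟩

end Brouwer

/-! ### The component group of a compact group -/

section ComponentGroup

variable {G : Type*} [TopologicalSpace G] [Group G] [IsTopologicalGroup G]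

/-- Left translations carry components to components, so the cosets of the identity component are
the components. -/
theorem quotient_connectedComponentOfOne_eq_iff (x y : G) :
    (x : G ⧸ Subgroup.connectedComponentOfOne G) = y ↔
      (x : ConnectedComponents G) = y := by
  rw [QuotientGroup.eq, ConnectedComponents.coe_eq_coe, eq_comm, connectedComponent_eq_iff_mem]
  change x⁻¹ * y ∈ connectedComponent (1 : G) ↔ _
  constructor <;> intro h
  · have := (continuous_const_mul x).image_connectedComponent_subset 1 (mem_image_of_mem _ h)
    simpa using this
  · have := (continuous_const_mul x⁻¹).image_connectedComponent_subset x (mem_image_of_mem _ h)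
    simpa using this

variable (G) in
/-- The map from the quotient of a topological group by its identity component to its space of
connected components. -/
def quotientToConnectedComponents :
    G ⧸ Subgroup.connectedComponentOfOne G → ConnectedComponents G :=
  Quotient.lift (fun x : G => (x : ConnectedComponents G)) fun x y h =>
    (quotient_connectedComponentOfOne_eq_iff x y).1 (Quotient.sound h)

theorem continuous_quotientToConnectedComponents :
    Continuous (quotientToConnectedComponents G) :=
  ConnectedComponents.continuous_coe.quotient_lift _

theorem injective_quotientToConnectedComponents :
    Function.Injective (quotientToConnectedComponents G) := by
  rintro ⟨x⟩ ⟨y⟩ h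
  exact (quotient_connectedComponentOfOne_eq_iff x y).2 h

instance totallyDisconnectedSpace_quotient_connectedComponentOfOne :
    TotallyDisconnectedSpace (G ⧸ Subgroup.connectedComponentOfOne G) :=
  ⟨isTotallyDisconnected_of_image continuous_quotientToConnectedComponents.continuousOn
    injective_quotientToConnectedComponents (isTotallyDisconnected_of_totallyDisconnectedSpace _)⟩

/-- An infinite quotient of a compact group has no isolated points. -/
theorem not_isOpen_singleton_of_infinite_quotient [CompactSpace G] (N : Subgroup G)
    [Infinite (G ⧸ N)] (x : G ⧸ N) : ¬ IsOpen {x} := by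
  intro hx
  have : DiscreteTopology (G ⧸ N) := discreteTopology_iff_isOpen_singleton.2 fun y => by
    obtain ⟨g, rfl⟩ := MulAction.exists_smul_eq G x y
    rw [← image_singleton (f := fun z => g • z)]
    exact isOpenMap_smul g _ hx
  exact not_finite_iff_infinite.2 ‹_› (finite_of_compact_of_discrete (X := G ⧸ N))

/-- If a compact metrizable group has infinitely many connected components, then its component
group is homeomorphic to the Cantor set. -/
theorem nonempty_quotient_homeomorph_cantorSet [CompactSpace G] [T2Space G]
    [SecondCountableTopology G] [Infinite (G ⧸ Subgroup.connectedComponentOfOne G)] :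
    Nonempty ((G ⧸ Subgroup.connectedComponentOfOne G) ≃ₜ cantorSet) := by
  have : T2Space (G ⧸ Subgroup.connectedComponentOfOne G) :=
    T2Space.of_injective_continuous injective_quotientToConnectedComponents
      continuous_quotientToConnectedComponents
  obtain ⟨e⟩ := nonempty_homeomorph_nat_bool (X := G ⧸ Subgroup.connectedComponentOfOne G)
    (not_isOpen_singleton_of_infinite_quotient _)
  exact ⟨e.trans cantorSetHomeomorphNatToBool.symm⟩

theorem not_connectedSpace_of_nontrivial_quotient
    [Nontrivial (G ⧸ Subgroup.connectedComponentOfOne G)] : ¬ ConnectedSpace G := by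
  intro h
  have : PreconnectedSpace (G ⧸ Subgroup.connectedComponentOfOne G) :=
    QuotientGroup.mk_surjective.denseRange.preconnectedSpace QuotientGroup.continuous_mk
  exact not_subsingleton (G ⧸ Subgroup.connectedComponentOfOne G)
    subsingleton_of_preconnected_totallyDisconnected

end ComponentGroup

/-! ### Subgroups that split into many open pieces -/

section Pieces

variable {G : Type*} [TopologicalSpace G] [Group G]

/-- The compact subgroups that split into at least `N` disjoint nonempty relatively open pieces. -/
def manyPieces (G : Type*) [TopologicalSpace G] [Group G] (N : ℕ) : Set (CompactSubgroups G) :=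
  {K | ∃ n ≥ N, ∃ U : Fin n → Set G, (∀ i, IsOpen (U i)) ∧ Pairwise (Function.onFun Disjoint U) ∧
    (K.1 : Set G) ⊆ ⋃ i, U i ∧ ∀ i, ((K.1 : Set G) ∩ U i).Nonempty}

theorem isOpen_manyPieces (N : ℕ) : IsOpen (manyPieces G N) := by
  rw [isOpen_iff_mem_nhds]
  rintro K ⟨n, hn, U, hU, hd, hc, hne⟩
  have h₁ : IsOpen {L : CompactSubgroups G | (L.1 : Set G) ⊆ ⋃ i, U i} :=
    (NonemptyCompacts.isOpen_subsets_of_isOpen (isOpen_iUnion hU)).preimage continuous_subtype_val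
  have h₂ : ∀ i, IsOpen {L : CompactSubgroups G | ((L.1 : Set G) ∩ U i).Nonempty} := fun i =>
    (NonemptyCompacts.isOpen_inter_nonempty_of_isOpen (hU i)).preimage continuous_subtype_val
  filter_upwards [h₁.mem_nhds hc, eventually_all.2 fun i => (h₂ i).mem_nhds (hne i)] with L hL hL'
  exact ⟨n, hn, U, hU, hd, hL, hL'⟩

variable [IsTopologicalGroup G]

/-- Each piece is relatively clopen, its complement being the union of the others, so points of
different pieces lie in different components. -/
theorem infinite_quotient_of_mem_manyPieces {K : CompactSubgroups G}
    (hK : ∀ N, K ∈ manyPieces G N) :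
    Infinite (CompactSubgroups.toSubgroup K ⧸
      Subgroup.connectedComponentOfOne (CompactSubgroups.toSubgroup K)) := by
  by_contra hinf
  rw [not_infinite_iff_finite] at hinf
  obtain ⟨n, hn, U, hU, hd, hc, hne⟩ :=
    hK (Nat.card (CompactSubgroups.toSubgroup K ⧸
      Subgroup.connectedComponentOfOne (CompactSubgroups.toSubgroup K)) + 1)
  choose x hxK hxU using hne
  let y : Fin n → CompactSubgroups.toSubgroup K := fun i => ⟨x i, hxK i⟩
  have hclopen : ∀ i, IsClopen {z : CompactSubgroups.toSubgroup K | (z : G) ∈ U i} := by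
    intro i
    refine ⟨⟨?_⟩, (hU i).preimage continuous_subtype_val⟩
    have : {z : CompactSubgroups.toSubgroup K | (z : G) ∈ U i}ᶜ =
        ⋃ j : {j // j ≠ i}, {z : CompactSubgroups.toSubgroup K | (z : G) ∈ U j} := by
      ext z
      simp only [mem_compl_iff, mem_ofPred_eq, mem_iUnion]
      constructor
      · intro hz
        obtain ⟨j, hj⟩ := mem_iUnion.1 (hc z.2)
        exact ⟨⟨j, by rintro rfl; exact hz hj⟩, hj⟩
      · rintro ⟨⟨j, hji⟩, hj⟩ hi
        exact (disjoint_left.1 (hd hji)) hj hi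
    rw [this]
    exact isOpen_iUnion fun j => (hU j).preimage continuous_subtype_val
  have hinj : Function.Injective
      fun i => (y i : CompactSubgroups.toSubgroup K ⧸
        Subgroup.connectedComponentOfOne (CompactSubgroups.toSubgroup K)) := by
    intro i j hij
    have h := (quotient_connectedComponentOfOne_eq_iff _ _).1 hij
    rw [ConnectedComponents.coe_eq_coe, eq_comm, connectedComponent_eq_iff_mem] at h
    have hi := (hclopen i).connectedComponent_subset (hxU i : y i ∈ _) h
    by_contra hne
    exact (disjoint_left.1 (hd hne)) hi (hxU j)
  have := Nat.card_le_card_of_injective _ hinj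
  rw [Nat.card_fin] at this
  omega

end Pieces

/-! ### Replacing the tail of a subgroup of a product -/

section Tail

variable {Y : ℕ+ → Type*}

/-- A basic open box constrains finitely many coordinates. The bound on `m` is uniform over a
neighbourhood, as the compactness argument in `tendsto_spliceSubgroup` requires. -/
theorem eventually_forall_agree_mem [∀ n, TopologicalSpace (Y n)] {U : Set (∀ n, Y n)}
    (hU : IsOpen U) {g : ∀ n, Y n} (hg : g ∈ U) :
    ∃ V ∈ 𝓝 g, ∀ᶠ m : ℕ+ in atTop, ∀ h ∈ V, ∀ p : ∀ n, Y n, (∀ n ≤ m, p n = h n) → p ∈ U := by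
  obtain ⟨I, u, hu, hIU⟩ := isOpen_pi_iff.1 hU g hg
  refine ⟨(I : Set ℕ+).pi u, set_pi_mem_nhds I.finite_toSet fun i hi =>
    (hu i hi).1.mem_nhds (hu i hi).2, ?_⟩
  filter_upwards [(eventually_all_finset I).2 fun i _ => eventually_ge_atTop i]
    with m hm h hh p hp
  exact hIU fun i hi => by rw [hp i (hm i hi)]; exact hh i hi

variable [∀ n, Group (Y n)]

/-- The homomorphism sending `(g, q)` to the family that agrees with `g` up to `m` and with `q`
beyond. -/
def spliceHom (Y : ℕ+ → Type*) [∀ n, Group (Y n)] (m : ℕ+) :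
    (∀ n, Y n) × (∀ n, Y n) →* ∀ n, Y n where
  toFun p n := if n ≤ m then p.1 n else p.2 n
  map_one' := by ext n; simp
  map_mul' p q := by ext n; dsimp; split_ifs <;> rfl

theorem spliceHom_apply_of_le {m n : ℕ+} (h : n ≤ m) (p : (∀ n, Y n) × (∀ n, Y n)) :
    spliceHom Y m p n = p.1 n := if_pos h

theorem spliceHom_apply_of_lt {m n : ℕ+} (h : m < n) (p : (∀ n, Y n) × (∀ n, Y n)) :
    spliceHom Y m p n = p.2 n := if_neg h.not_ge

variable [∀ n, TopologicalSpace (Y n)]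

theorem continuous_spliceHom (m : ℕ+) : Continuous (spliceHom Y m) := by
  refine continuous_pi fun n => ?_
  change Continuous fun p : (∀ n, Y n) × (∀ n, Y n) => if n ≤ m then p.1 n else p.2 n
  split_ifs <;> fun_prop

/-- The compact subgroup obtained from `K` by keeping its projection to the coordinates up to `m`
and replacing the remaining coordinates by the product of the finite subgroups `Z n`. -/
def spliceSubgroup (K : CompactSubgroups (∀ n, Y n)) (Z : ∀ n, Subgroup (Y n))
    (hZ : ∀ n, (Z n : Set (Y n)).Finite) (m : ℕ+) : CompactSubgroups (∀ n, Y n) :=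
  ⟨⟨⟨spliceHom Y m '' ((K.1 : Set _) ×ˢ Set.univ.pi fun n => (Z n : Set (Y n))),
      (K.1.isCompact.prod (isCompact_univ_pi fun n => (hZ n).isCompact)).image
        (continuous_spliceHom m)⟩,
      (K.1.nonempty.prod (univ_pi_nonempty_iff.2 fun n => ⟨1, (Z n).one_mem⟩)).image _⟩,
    ((CompactSubgroups.toSubgroup K).prod (Subgroup.pi Set.univ Z)).map (spliceHom Y m), by
      simp [Subgroup.coe_prod, Subgroup.coe_pi, CompactSubgroups.toSubgroup]⟩

theorem mem_spliceSubgroup {K : CompactSubgroups (∀ n, Y n)} {Z : ∀ n, Subgroup (Y n)}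
    {hZ : ∀ n, (Z n : Set (Y n)).Finite} {m : ℕ+} {p : ∀ n, Y n} :
    p ∈ (spliceSubgroup K Z hZ m).1 ↔
      ∃ g ∈ K.1, ∃ q : ∀ n, Y n, (∀ n, q n ∈ Z n) ∧ spliceHom Y m (g, q) = p := by
  change p ∈ spliceHom Y m '' ((K.1 : Set _) ×ˢ Set.univ.pi fun n => (Z n : Set (Y n))) ↔ _
  simp [and_assoc]

theorem tendsto_spliceSubgroup (K : CompactSubgroups (∀ n, Y n)) (Z : ∀ n, Subgroup (Y n))
    (hZ : ∀ n, (Z n : Set (Y n)).Finite) :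
    Tendsto (spliceSubgroup K Z hZ) atTop (𝓝 K) := by
  rw [IsEmbedding.subtypeVal.tendsto_nhds_iff]
  let _ := TopologicalSpace.vietoris (∀ n, Y n)
  rw [NonemptyCompacts.isEmbedding_coe.tendsto_nhds_iff, tendsto_nhds_generateFrom_iff]
  -- Two kinds of subbasic Vietoris sets: being contained in `U`, and meeting `U`.
  rintro _ (⟨U, hU, rfl⟩ | ⟨U, hU, rfl⟩) hK
  · have hKU : (K.1 : Set (∀ n, Y n)) ⊆ U := hK
    have key : ∀ᶠ m : ℕ+ in atTop, ∀ h ∈ (K.1 : Set (∀ n, Y n)), ∀ p : ∀ n, Y n,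
        (∀ n ≤ m, p n = h n) → p ∈ U := by
      refine K.1.isCompact.induction_on (p := fun s => ∀ᶠ m : ℕ+ in atTop, ∀ h ∈ s,
        ∀ p : ∀ n, Y n, (∀ n ≤ m, p n = h n) → p ∈ U) ?_ ?_ ?_ ?_
      · simp
      · exact fun s t hst ht => ht.mono fun m hm h hh => hm h (hst hh)
      · intro s t hs ht
        filter_upwards [hs, ht] with m h₁ h₂ h hh
        exact hh.elim (h₁ h) (h₂ h)
      · intro g hg
        obtain ⟨V, hV, h⟩ := eventually_forall_agree_mem hU (hKU hg)
        exact ⟨V, mem_nhdsWithin_of_mem_nhds hV, h⟩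
    filter_upwards [key] with m hm p hp
    obtain ⟨g, hg, q, -, rfl⟩ := mem_spliceSubgroup.1 hp
    exact hm g hg _ fun n hn => spliceHom_apply_of_le hn _
  · obtain ⟨g, hg, hgU⟩ := hK
    obtain ⟨V, hV, h⟩ := eventually_forall_agree_mem hU hgU
    filter_upwards [h] with m hm
    exact ⟨spliceHom Y m (g, 1), mem_spliceSubgroup.2 ⟨g, hg, 1, fun n => (Z n).one_mem, rfl⟩,
      hm g (mem_of_mem_nhds hV) _ fun n hn => spliceHom_apply_of_le hn _⟩

/-- Beyond `m`, coordinate `n` ranges over exactly the finite group `Z n`; pull back disjoint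
neighbourhoods of its elements. -/
theorem spliceSubgroup_mem_manyPieces [∀ n, T2Space (Y n)] (K : CompactSubgroups (∀ n, Y n))
    (Z : ∀ n, Subgroup (Y n)) (hZ : ∀ n, (Z n : Set (Y n)).Finite) {m n : ℕ+} (hmn : m < n) :
    spliceSubgroup K Z hZ m ∈ manyPieces (∀ n, Y n) (Nat.card (Z n)) := by
  have := (hZ n).to_subtype
  obtain ⟨U, hU, hd⟩ := (hZ n).t2_separation
  let e := (Finite.equivFin (Z n)).symm
  refine ⟨Nat.card (Z n), le_rfl, fun i => (fun p => p n) ⁻¹' U (e i),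
    fun i => (hU _).2.preimage (continuous_apply n), fun i j hij => ?_, ?_, fun i => ?_⟩
  · exact (hd (e i).2 (e j).2 fun h => hij (e.injective (Subtype.ext h))).preimage _
  · intro p hp
    obtain ⟨g, -, q, hq, rfl⟩ := mem_spliceSubgroup.1 hp
    refine mem_iUnion.2 ⟨e.symm ⟨q n, hq n⟩, ?_⟩
    simpa [spliceHom_apply_of_lt hmn] using (hU (q n)).1
  · obtain ⟨g, hg⟩ := K.1.nonempty
    refine ⟨spliceHom Y m (g, Pi.mulSingle n (e i)), mem_spliceSubgroup.2
      ⟨g, hg, _, fun k => ?_, rfl⟩, ?_⟩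
    · by_cases hk : k = n
      · subst hk
        simp
      · simp [Pi.mulSingle_eq_of_ne hk]
    · simpa [spliceHom_apply_of_lt hmn] using (hU (e i)).1

end Tail

/-! ### The product of the special unitary groups -/

instance secondCountableTopology_specialUnitaryGroup (n : ℕ) :
    SecondCountableTopology (SU n) :=
  have : SecondCountableTopology (Matrix (Fin n) (Fin n) ℂ) :=
    inferInstanceAs (SecondCountableTopology (Fin n → Fin n → ℂ))
  TopologicalSpace.Subtype.secondCountableTopology _

theorem exists_orderOf_specialUnitaryGroup (n : ℕ) [NeZero n] : ∃ a : SU n, orderOf a = n := by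
  have hζ := Complex.isPrimitiveRoot_exp n (NeZero.ne n)
  set ζ := Complex.exp (2 * Real.pi * Complex.I / n)
  have hnorm : ‖ζ‖ = 1 := hζ.norm'_eq_one (NeZero.ne n)
  -- The scalar matrix of a primitive `n`-th root of unity has determinant `ζ ^ n = 1`.
  have hmem : ζ • (1 : Matrix (Fin n) (Fin n) ℂ) ∈ Matrix.specialUnitaryGroup (Fin n) ℂ := by
    rw [Matrix.mem_specialUnitaryGroup_iff, Matrix.mem_unitaryGroup_iff]
    refine ⟨?_, by simp [hζ.pow_eq_one]⟩
    have : star ζ * ζ = 1 := by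
      rw [mul_comm, Complex.star_def, Complex.mul_conj, Complex.normSq_eq_norm_sq, hnorm]; simp
    simp [star_smul, smul_smul, this, -Complex.star_def, -RCLike.star_def]
  refine ⟨⟨_, hmem⟩, ?_⟩
  have : ∀ k : ℕ, (⟨_, hmem⟩ : SU n) ^ k = 1 ↔ ζ ^ k = 1 := by
    intro k
    rw [Subtype.ext_iff]
    simp only [SubmonoidClass.coe_pow, smul_pow, one_pow, OneMemClass.coe_one]
    constructor
    · intro h
      simpa using congrFun (congrFun h 0) 0
    · intro h
      rw [h, one_smul]
  exact (orderOf_eq_orderOf_iff.2 this).trans hζ.eq_orderOf.symm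

theorem dense_manyPieces (N : ℕ) : Dense (manyPieces ProdSU N) := by
  choose a ha using fun n : ℕ+ => exists_orderOf_specialUnitaryGroup n
  have hZ : ∀ n : ℕ+, (Subgroup.zpowers (a n) : Set (SU n)).Finite := fun n =>
    finite_zpowers.2 (orderOf_pos_iff.1 (by rw [ha]; exact n.pos))
  intro K
  refine mem_closure_of_tendsto (tendsto_spliceSubgroup K _ hZ) ?_
  filter_upwards [eventually_ge_atTop N.succPNat] with m hm
  obtain ⟨n, hn, h⟩ := spliceSubgroup_mem_manyPieces K _ hZ (PNat.lt_add_right m 1)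
  rw [Nat.card_zpowers, ha] at hn
  refine ⟨n, le_trans ?_ hn, h⟩
  have : N + 1 ≤ (m : ℕ) := hm
  rw [PNat.add_coe]
  omega

theorem eventually_residual_infinite_quotient :
    ∀ᶠ K : CompactSubgroups ProdSU in residual (CompactSubgroups ProdSU),
      Infinite (CompactSubgroups.toSubgroup K ⧸
        Subgroup.connectedComponentOfOne (CompactSubgroups.toSubgroup K)) := by
  filter_upwards [eventually_countable_forall.2 fun N =>
    residual_of_dense_open (isOpen_manyPieces N) (dense_manyPieces N)] with K hK
  exact infinite_quotient_of_mem_manyPieces hK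

theorem theorem5p8 :
    (∀ᶠ K : CompactSubgroups ProdSU in residual (CompactSubgroups ProdSU),
      Nonempty ((CompactSubgroups.toSubgroup K ⧸
        Subgroup.connectedComponentOfOne (CompactSubgroups.toSubgroup K)) ≃ₜ cantorSet)) ∧
    (∀ᶠ K : CompactSubgroups ProdSU in residual (CompactSubgroups ProdSU),
      ¬ ConnectedSpace (CompactSubgroups.toSubgroup K)) := by
  refine ⟨?_, ?_⟩
  · filter_upwards [eventually_residual_infinite_quotient] with K hK
    have : CompactSpace (CompactSubgroups.toSubgroup K) :=
      isCompact_iff_compactSpace.1 K.1.isCompact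
    have : SecondCountableTopology (CompactSubgroups.toSubgroup K) :=
      TopologicalSpace.Subtype.secondCountableTopology _
    exact nonempty_quotient_homeomorph_cantorSet
  · filter_upwards [eventually_residual_infinite_quotient] with K hK
    exact not_connectedSpace_of_nontrivial_quotient
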